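/- Let $S=\{1,\dots,N\}$, $\mathfrak P=\{\alpha\in\mathbb R_+^N:\sum_{j}\alpha_j=1\}$, and let $\kappa:\{0,1,2,\dots\}\times S\times\mathfrak P\to\mathbb R$ be continuous with $$\sum_{t=0}^\infty\ \sup_{(i,\alpha)\in S\times\mathfrak P}|\kappa(t,i,\alpha)|<\infty .$$ For each $i\in S$ let $\mathcal A_i\subseteq\mathfrak P$ be a non-empty set of admissible transition rows, and let $\mathcal A$ be the set of all $N\times N$ matrices $u$ whose $i$-th row $u_i$ lies in $\mathcal A_i$ for every $i\in S$. For $i\in S$ and $u\in\mathcal A$ put $$V(i,u)=\mathbb E_{i,u}\Big[\sum_{t=0}^\infty\kappa(t,X_t,u_{X_t})\Big],$$ where $X$ is the Markov chain with $X_0=i$ and transition matrix $u$. For $u,w\in\mathcal A$ let $V(i,u\otimes_1 w)$ be the analogous expected payoff when $u$ governs the chain and the payoff at time $0$ and $w$ governs them at all times $t\ge 1$: $$V(i,u\otimes_1 w)=\mathbb E\Big[\kappa(0,i,u_i)+\sum_{t=1}^\infty\kappa(t,X_t,w_{X_t})\Big],$$ where $X_0=i$, the transition from time $0$ to time $1$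 follows $u$, and all later transitions follow $w$. Call $u^*\in\mathcal A$ an equilibrium if $V(i,u^*)\ge V(i,u\otimes_1 u^*)$ for all $i\in S$ and $u\in\mathcal A$. Suppose that for every $i\in S$ the set $\mathcal A_i$ is convex and closed and the function $\kappa(0,i,\cdot)$ is concave on $\mathfrak P$. Then there exists an equilibrium. -/

import Mathlib

open MeasureTheory ProbabilityTheory

noncomputable section

namespace ControlledChain

/-- Transition matrices on the state space `Fin N`: row `i` is the probability vector
`u i`, whose entry `u i j` is the probability of a jump from `i` to `j`. -/
abbrev TransitionMatrix (N : ℕ) : Type := Fin N → stdSimplex ℝ (Fin N)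

/-- The probability measure on the state space `Fin N` given by a probability vector. -/
def rowMeasure {N : ℕ} (α : stdSimplex ℝ (Fin N)) : Measure (Fin N) :=
  ∑ j, ENNReal.ofReal (α j) • Measure.dirac j

instance {N : ℕ} (α : stdSimplex ℝ (Fin N)) : IsProbabilityMeasure (rowMeasure α) := by
  constructor
  simp only [rowMeasure, Measure.coe_finsetSum, Finset.sum_apply, Measure.smul_apply,
    measure_univ, smul_eq_mul, mul_one]
  rw [← ENNReal.ofReal_sum_of_nonneg (s := Finset.univ) (f := fun j => α j) (fun j _ => α.2.1 j)]
  exact (congrArg ENNReal.ofReal α.2.2).trans ENNReal.ofReal_one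

/-- The Markov kernel on the state space given by a transition matrix. -/
def stepKernel {N : ℕ} (u : TransitionMatrix N) : Kernel (Fin N) (Fin N) :=
  Kernel.ofFunOfCountable fun i => rowMeasure (u i)

instance {N : ℕ} (u : TransitionMatrix N) : IsMarkovKernel (stepKernel u) :=
  ⟨fun i => inferInstanceAs (IsProbabilityMeasure (rowMeasure (u i)))⟩

/-- The conditional law of `X (n + 1)` given the history `X 0, …, X n`, when the transition
from time `n` to time `n + 1` is governed by `u`: only the current state `X n` matters. -/
def historyKernel {N : ℕ} (u : TransitionMatrix N) (n : ℕ) :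
    Kernel ((k : Finset.Iic n) → (fun _ : ℕ => Fin N) k) (Fin N) :=
  (stepKernel u).comap (fun h => h ⟨n, Finset.mem_Iic.2 le_rfl⟩) (measurable_pi_apply _)

instance {N : ℕ} (u : TransitionMatrix N) (n : ℕ) : IsMarkovKernel (historyKernel u n) := by
  unfold historyKernel; infer_instance

/-- The law, on the path space `ℕ → Fin N`, of the Markov chain that starts at `i` and whose
transition from time `n` to time `n + 1` is governed by the transition matrix `π n`. -/
def chainLaw {N : ℕ} (π : ℕ → TransitionMatrix N) (i : Fin N) : Measure (ℕ → Fin N) :=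
  Kernel.traj (X := fun _ => Fin N) (fun n => historyKernel (π n) n) 0 (fun _ => i)

/-- The expected payoff `𝔼 [∑ t, κ (t, X t, α t)]`, where `X` starts at `i` and is governed at
each time `t` by the matrix `π t`, and where `α t` is row `X t` of `π t`. -/
def policyPayoff {N : ℕ} (κ : ℕ → Fin N → (Fin N → ℝ) → ℝ) (i : Fin N)
    (π : ℕ → TransitionMatrix N) : ℝ :=
  ∫ x, ∑' t, κ t (x t) (π t (x t)) ∂(chainLaw π i)

/-- The expected payoff `V(i, u)` when the matrix `u` is used at all times. -/
def payoff {N : ℕ} (κ : ℕ → Fin N → (Fin N → ℝ) → ℝ) (i : Fin N)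
    (u : TransitionMatrix N) : ℝ :=
  policyPayoff κ i fun _ => u

/-- The concatenation of `u` and `w` at time `1`: the chain is governed by `u` at time `0` and
by `w` at all subsequent times. -/
def concat {N : ℕ} (u w : TransitionMatrix N) : ℕ → TransitionMatrix N
  | 0 => u
  | _ + 1 => w

/-- The transition matrices each of whose rows is admissible. -/
def admissible {N : ℕ} (A : Fin N → Set (Fin N → ℝ)) : Set (TransitionMatrix N) :=
  {u | ∀ i, (u i : Fin N → ℝ) ∈ A i}

/-- `w` is an equilibrium: it is admissible, and from no state is it profitable to deviate from
`w` to some admissible `u` at time `0` only. -/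
def IsEquilibrium {N : ℕ} (κ : ℕ → Fin N → (Fin N → ℝ) → ℝ) (A : Fin N → Set (Fin N → ℝ))
    (w : TransitionMatrix N) : Prop :=
  w ∈ admissible A ∧
    ∀ i, ∀ u ∈ admissible A, policyPayoff κ i (concat u w) ≤ payoff κ i w

end ControlledChain

end

/-! Conditioning on the first step gives $V(i,u\otimes_1 w)=\kappa(0,i,u_i)+u_i\cdot G_w$
(`policyPayoff_concat`), where the continuation value $G_w$ depends only on $w$, and continuously so
(`continuousOn_continuation`). Hence $w$ is an equilibrium iff each row $w_i$ maximises the concave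
function $h_i(\alpha,w)=\kappa(0,i,\alpha)+\alpha\cdot G_w$ over $\mathcal A_i$.

Such a $w$ comes from the Ky Fan inequality (`exists_forall_nonpos_of_concaveOn`) on the compact
convex set $\prod_i\mathcal A_i$ for $\varphi(u,w)=\sum_i\big(h_i(u_i,w)-h_i(w_i,w)\big)$, which is
concave in $u$, continuous in $w$ and zero on the diagonal. By compactness, finitely many test
points suffice. Their convex combinations are parametrised by a simplex, where a covering theorem of
KKM type applies; it is the limit of Scarf's lemma on finer and finer grids. -/

/-! ### Scarf's combinatorial lemma -/

section Scarf

variable {X I L : Type*} [LinearOrder L]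

/-- A set `S` is dominant for a family of order-valued maps `V i` if no point is, for every `i`,
strictly above the `V i`-minimum of `S`. -/
def IsDominant (V : I → X → L) (S : Finset X) : Prop :=
  ∀ y, ∃ i, ∀ x ∈ S, V i y ≤ V i x

/-- A family of linear orders on `X` (pulled back along injections `V i`) with slack elements
`e i`: the element `e i` is the least one in the order `i` and, in the other orders, lies above
all elements that are not slack. -/
structure IsSlackFamily (V : I → X → L) (e : I → X) : Prop where
  injective : ∀ i, Function.Injective (V i)
  slack_lt : ∀ i x, x ≠ e i → V i (e i) < V i x
  lt_slack : ∀ i j x, x ∉ Set.range e → j ≠ i → V i x < V i (e j)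

theorem IsDominant.mono {V : I → X → L} {S R : Finset X} (h : IsDominant V R) (hSR : S ⊆ R) :
    IsDominant V S := fun y => by
  obtain ⟨i, hi⟩ := h y
  exact ⟨i, fun x hx => hi x (hSR hx)⟩

variable [DecidableEq X] [Fintype I] [DecidableEq I]

/-- A set of full size that misses a colour has an even number of facets on which exactly the
colours other than `i₀` occur. -/
theorem even_card_facets {c : X → I} {R : Finset X} (hR : R.card = Fintype.card I)
    (hc : R.image c ≠ Finset.univ) (i₀ : I) :
    Even (R.filter fun x => (R.erase x).image c = Finset.univ.erase i₀).card := by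
  rcases Finset.eq_empty_or_nonempty
    (R.filter fun x => (R.erase x).image c = Finset.univ.erase i₀) with h | ⟨x, hx⟩
  · rw [h]; simp
  obtain ⟨hxR, hx⟩ := Finset.mem_filter.1 hx
  -- Such a facet has as many elements as colours, so `c` is injective on it. As `R` misses a
  -- colour, `c x ≠ i₀`; so exactly one other element `y` repeats the colour of `x`, and only `x`
  -- and `y` can be removed.
  have hinj : ∀ z ∈ R, (R.erase z).image c = Finset.univ.erase i₀ →
      Set.InjOn c (R.erase z : Finset X) := fun z hz h => by
    rw [← Finset.card_image_iff, h, Finset.card_erase_of_mem hz,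
      Finset.card_erase_of_mem (Finset.mem_univ _), hR, Finset.card_univ]
  have hcx : c x ≠ i₀ := by
    intro h
    apply hc
    rw [← Finset.insert_erase hxR, Finset.image_insert, hx, h,
      Finset.insert_erase (Finset.mem_univ _)]
  obtain ⟨y, hy, hyx⟩ := Finset.mem_image.1
    (hx ▸ Finset.mem_erase.2 ⟨hcx, Finset.mem_univ _⟩ : c x ∈ (R.erase x).image c)
  obtain ⟨hne, hyR⟩ := Finset.mem_erase.1 hy
  have : (R.filter fun x => (R.erase x).image c = Finset.univ.erase i₀) = {x, y} := by
    ext z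
    simp only [Finset.mem_filter, Finset.mem_insert, Finset.mem_singleton]
    constructor
    · rintro ⟨hz, h⟩
      by_contra! hzz
      exact hne (hinj z hz h (by simp [hzz.2.symm, hyR]) (by simp [hzz.1.symm, hxR]) hyx)
    · rintro (rfl | rfl)
      · exact ⟨hxR, hx⟩
      · refine ⟨hyR, ?_⟩
        rw [← hx, ← Finset.insert_erase (Finset.mem_erase.2 ⟨hne.symm, hxR⟩ : x ∈ R.erase z),
          ← Finset.insert_erase hy, Finset.image_insert, Finset.image_insert, hyx,
          Finset.erase_right_comm]
  rw [this, Finset.card_pair hne.symm]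
  exact even_two

variable [Fintype X]

open Classical in
/-- A dominant set of one element less than the number of orders extends in exactly two ways to a
dominant set of full size, if it contains an element that is not slack. -/
theorem IsSlackFamily.card_extensions {V : I → X → L} {e : I → X} (hV : IsSlackFamily V e)
    {S : Finset X} (hS : IsDominant V S) (hcard : S.card + 1 = Fintype.card I)
    {t : X} (htS : t ∈ S) (ht : t ∉ Set.range e) :
    (Finset.univ.filter fun x => x ∉ S ∧ IsDominant V (insert x S)).card = 2 := by
  have hmin : ∀ i, ∃ s ∈ S, ∀ x ∈ S, V i s ≤ V i x := fun i => S.exists_min_image (V i) ⟨t, htS⟩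
  choose μ hμS hμ using hmin
  -- By dominance every element of `S` is the minimum in some order. There is one order more than
  -- elements, so some element is the minimum in two orders `a` and `b`; a new element must take
  -- over one of these two roles.
  have hsurj : ∀ s ∈ S, ∃ i, μ i = s := fun s hs => by
    obtain ⟨i, hi⟩ := hS s
    exact ⟨i, hV.injective i (le_antisymm (hμ i s hs) (hi _ (hμS i)))⟩
  obtain ⟨a, -, b, -, hab, hμab⟩ := Finset.exists_ne_map_eq_of_card_lt_of_maps_to
    (s := (Finset.univ : Finset I)) (t := S) (f := μ)
    (by rw [Finset.card_univ]; omega) (fun i _ => hμS i)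
  -- The candidate taking over order `k` is the `V k`-largest point above the other minima; `e k` is
  -- such a point because `S` contains the non-slack `t`.
  have hmax : ∀ k, ∃ x, (∀ i, i ≠ k → V i (μ i) < V i x) ∧
      ∀ y, (∀ i, i ≠ k → V i (μ i) < V i y) → V k y ≤ V k x := fun k => by
    obtain ⟨x, hx, hx'⟩ := (Finset.univ.filter fun x => ∀ i, i ≠ k → V i (μ i) < V i x).exists_max_image
      (V k) ⟨e k, by
        simp only [Finset.mem_filter, Finset.mem_univ, true_and]
        exact fun i hi => (hμ i t htS).trans_lt (hV.lt_slack i k t ht hi.symm)⟩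
    simp only [Finset.mem_filter, Finset.mem_univ, true_and] at hx hx'
    exact ⟨x, hx, hx'⟩
  have hfwd : ∀ x, x ∉ S → IsDominant V (insert x S) → ∃ k, (k = a ∨ k = b) ∧
      (∀ i, i ≠ k → V i (μ i) < V i x) ∧
      ∀ y, (∀ i, i ≠ k → V i (μ i) < V i y) → V k y ≤ V k x := by
    intro x hxS hdom
    -- `f s` is an order in which `s` is the minimum of `insert x S`. Counting makes `f` a bijection
    -- onto the orders, so `x` displaces the minimum in the order `f x` alone.
    choose f hf using fun s : X => hdom s
    have hinj : Set.InjOn f (insert x S : Finset X) := fun s hs s' hs' h =>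
      hV.injective (f s) (le_antisymm (hf s s' hs') (h ▸ hf s' s hs))
    have himg : (insert x S).image f = Finset.univ := by
      rw [← Finset.card_eq_iff_eq_univ, Finset.card_image_of_injOn hinj,
        Finset.card_insert_of_notMem hxS, hcard]
    have key : ∀ i, i ≠ f x → f (μ i) = i ∧ V i (μ i) < V i x := by
      intro i hi
      obtain ⟨s, hs, rfl⟩ := Finset.mem_image.1 (himg ▸ Finset.mem_univ i)
      rcases Finset.mem_insert.1 hs with rfl | hs
      · exact absurd rfl hi
      have : μ (f s) = s := hV.injective (f s) (le_antisymm (hμ _ s hs)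
        (hf s _ (Finset.mem_insert_of_mem (hμS _))))
      refine ⟨by rw [this], lt_of_le_of_ne (this.symm ▸ hf s x (Finset.mem_insert_self _ _)) ?_⟩
      intro h
      exact hxS (hV.injective _ h ▸ hμS _)
    refine ⟨f x, ?_, fun i hi => (key i hi).2, fun y hy => ?_⟩
    · by_contra! h
      exact hab ((key a h.1.symm).1.symm.trans (hμab ▸ (key b h.2.symm).1))
    · obtain ⟨i, hi⟩ := hdom y
      by_cases hix : i = f x
      · exact hix ▸ hi x (Finset.mem_insert_self _ _)
      · exact absurd (hi _ (Finset.mem_insert_of_mem (hμS i))) (not_le.2 (hy i hix))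
  have hbwd : ∀ k l, k ≠ l → μ k = μ l → ∀ x, (∀ i, i ≠ k → V i (μ i) < V i x) →
      (∀ y, (∀ i, i ≠ k → V i (μ i) < V i y) → V k y ≤ V k x) →
      x ∉ S ∧ IsDominant V (insert x S) := by
    intro k l hkl hμkl x hx hx'
    refine ⟨fun hxS => ?_, fun y => ?_⟩
    · obtain ⟨j, rfl⟩ := hsurj x hxS
      by_cases hj : j = k
      · subst hj
        exact absurd (hx l hkl.symm) (by rw [hμkl]; exact lt_irrefl _)
      · exact lt_irrefl _ (hx j hj)
    · by_cases h : ∃ i, i ≠ k ∧ V i y ≤ V i (μ i)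
      · obtain ⟨i, hik, hi⟩ := h
        refine ⟨i, fun z hz => ?_⟩
        rcases Finset.mem_insert.1 hz with rfl | hz
        · exact hi.trans (hx i hik).le
        · exact hi.trans (hμ i z hz)
      · push Not at h
        refine ⟨k, fun z hz => ?_⟩
        rcases Finset.mem_insert.1 hz with rfl | hz
        · exact hx' y h
        · obtain ⟨i, hi⟩ := hS y
          by_cases hik : i = k
          · exact hik ▸ hi z hz
          · exact absurd (hi _ (hμS i)) (not_le.2 (h i hik))
  obtain ⟨p, hp, hp'⟩ := hmax a
  obtain ⟨q, hq, hq'⟩ := hmax b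
  -- A common point would exceed the minimum of `S` in every order.
  have hpq : p ≠ q := by
    rintro rfl
    obtain ⟨i, hi⟩ := hS p
    by_cases hia : i = a
    · exact absurd (hi _ (hμS i)) (not_le.2 (hq i (hia ▸ hab)))
    · exact absurd (hi _ (hμS i)) (not_le.2 (hp i hia))
  rw [Finset.card_eq_two]
  refine ⟨p, q, hpq, ?_⟩
  ext x
  simp only [Finset.mem_filter, Finset.mem_univ, true_and, Finset.mem_insert, Finset.mem_singleton]
  constructor
  · rintro ⟨hxS, hdom⟩
    obtain ⟨k, rfl | rfl, h1, h2⟩ := hfwd x hxS hdom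
    · exact Or.inl (hV.injective _ (le_antisymm (hp' x h1) (h2 p hp)))
    · exact Or.inr (hV.injective _ (le_antisymm (hq' x h1) (h2 q hq)))
  · rintro (rfl | rfl)
    · exact hbwd a b hab hμab _ hp hp'
    · exact hbwd b a hab.symm hμab.symm _ hq hq'

open Classical in
/-- The set of all slack elements but one extends in exactly one way to a dominant set. -/
theorem IsSlackFamily.card_extensions_slack {V : I → X → L} {e : I → X} (hV : IsSlackFamily V e)
    (i₀ : I) {t₀ : X} (ht₀ : t₀ ∉ Set.range e) :
    (Finset.univ.filter fun x => x ∉ (Finset.univ.erase i₀).image e ∧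
      IsDominant V (insert x ((Finset.univ.erase i₀).image e))).card = 1 := by
  -- For `i ≠ i₀` the least element `e i` is already in the set, so only order `i₀` can block a
  -- non-slack point. The added element must therefore be the `V i₀`-largest non-slack one.
  obtain ⟨p, hp, hp'⟩ := (Finset.univ.filter fun x => x ∉ Set.range e).exists_max_image
      (V i₀) ⟨t₀, by simpa using ht₀⟩
  simp only [Finset.mem_filter, Finset.mem_univ, true_and] at hp hp'
  have hne : ∀ x ∉ Set.range e, ∀ i, x ≠ e i := fun x hx i h => hx ⟨i, h.symm⟩
  rw [Finset.card_eq_one]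
  refine ⟨p, ?_⟩
  ext x
  simp only [Finset.mem_filter, Finset.mem_univ, true_and, Finset.mem_singleton]
  have hmem : ∀ i, i ≠ i₀ → e i ∈ insert x ((Finset.univ.erase i₀).image e) := fun i hi =>
    Finset.mem_insert_of_mem (Finset.mem_image_of_mem _ (Finset.mem_erase.2 ⟨hi, Finset.mem_univ _⟩))
  constructor
  · rintro ⟨hxS, hdom⟩
    have hle : ∀ y ∉ Set.range e, V i₀ y ≤ V i₀ x := by
      intro y hy
      obtain ⟨i, hi⟩ := hdom y
      by_cases hi₀ : i = i₀
      · exact hi₀ ▸ hi x (Finset.mem_insert_self _ _)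
      · exact absurd (hi _ (hmem i hi₀)) (not_le.2 (hV.slack_lt i y (hne y hy i)))
    have hx : x ∉ Set.range e := by
      rintro ⟨j, rfl⟩
      by_cases hj : j = i₀
      · subst hj
        exact absurd (hle t₀ ht₀) (not_le.2 (hV.slack_lt _ _ (hne t₀ ht₀ _)))
      · exact hxS (Finset.mem_image_of_mem _ (Finset.mem_erase.2 ⟨hj, Finset.mem_univ _⟩))
    exact hV.injective i₀ (le_antisymm (hp' x hx) (hle p hp))
  · rintro rfl
    refine ⟨fun h => ?_, fun y => ?_⟩
    · obtain ⟨j, -, hj⟩ := Finset.mem_image.1 h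
      exact hp ⟨j, hj⟩
    · by_cases hy : y ∈ Set.range e
      · obtain ⟨j, rfl⟩ := hy
        refine ⟨j, fun z _ => ?_⟩
        by_cases hz : z = e j
        · rw [hz]
        · exact (hV.slack_lt j z hz).le
      · refine ⟨i₀, fun z hz => ?_⟩
        rcases Finset.mem_insert.1 hz with rfl | hz
        · exact hp' y hy
        · obtain ⟨j, hj, rfl⟩ := Finset.mem_image.1 hz
          exact (hV.lt_slack i₀ j y hy (Finset.ne_of_mem_erase hj)).le

/-- **Scarf's lemma**: whatever the colouring in which the slack element `e i` has colour `i`,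
there is a dominant set of full size in which every colour occurs. -/
theorem IsSlackFamily.exists_dominant_colourful {V : I → X → L} {e : I → X}
    (hV : IsSlackFamily V e) {t₀ : X} (ht₀ : t₀ ∉ Set.range e) (i₀ : I) {c : X → I}
    (hc : ∀ i, c (e i) = i) :
    ∃ S : Finset X, IsDominant V S ∧ S.card = Fintype.card I ∧ S.image c = Finset.univ := by
  classical
  by_contra! hno
  -- Parity argument: with no colourful room every room has an even number of doors, while every
  -- door leads to two rooms, except `S₀`, which leads to one.
  let rooms : Finset (Finset X) :=
    Finset.univ.filter fun R => IsDominant V R ∧ R.card = Fintype.card I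
  let doors : Finset (Finset X) := Finset.univ.filter fun S => IsDominant V S ∧
    S.card + 1 = Fintype.card I ∧ S.image c = Finset.univ.erase i₀
  let ext : Finset X → Finset X := fun S =>
    Finset.univ.filter fun x => x ∉ S ∧ IsDominant V (insert x S)
  let fac : Finset X → Finset X := fun R =>
    R.filter fun x => (R.erase x).image c = Finset.univ.erase i₀
  let S₀ : Finset X := (Finset.univ.erase i₀).image e
  have heinj : Function.Injective e := fun i j h => by rw [← hc i, ← hc j, h]
  have hcardI : 1 ≤ Fintype.card I := Fintype.card_pos_iff.2 ⟨i₀⟩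
  have hcount : (rooms.sigma fac).card = (doors.sigma ext).card := by
    refine Finset.card_bij' (fun p _ => (⟨p.1.erase p.2, p.2⟩ : Σ _ : Finset X, X))
      (fun p _ => (⟨insert p.2 p.1, p.2⟩ : Σ _ : Finset X, X)) ?_ ?_ ?_ ?_
    · rintro ⟨R, x⟩ h
      simp only [Finset.mem_sigma, rooms, fac, Finset.mem_filter, Finset.mem_univ, true_and] at h
      obtain ⟨⟨h1, h2⟩, h3, h4⟩ := h
      simp only [Finset.mem_sigma, doors, ext, Finset.mem_filter, Finset.mem_univ, true_and,
        Finset.insert_erase h3, Finset.notMem_erase, not_false_iff]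
      exact ⟨⟨h1.mono (Finset.erase_subset _ _), by rw [Finset.card_erase_of_mem h3]; omega, h4⟩, h1⟩
    · rintro ⟨S, x⟩ h
      simp only [Finset.mem_sigma, doors, ext, Finset.mem_filter, Finset.mem_univ, true_and] at h
      obtain ⟨⟨h1, h2, h3⟩, h4, h5⟩ := h
      simp only [Finset.mem_sigma, rooms, fac, Finset.mem_filter, Finset.mem_univ, true_and,
        Finset.mem_insert_self, Finset.erase_insert h4]
      exact ⟨⟨h5, by rw [Finset.card_insert_of_notMem h4, h2]⟩, h3⟩
    · rintro ⟨R, x⟩ h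
      simp only [Finset.mem_sigma, rooms, fac, Finset.mem_filter, Finset.mem_univ, true_and] at h
      simp only [Finset.insert_erase h.2.1]
    · rintro ⟨S, x⟩ h
      simp only [Finset.mem_sigma, doors, ext, Finset.mem_filter, Finset.mem_univ, true_and] at h
      simp only [Finset.erase_insert h.2.1]
  have heven : Even (rooms.sigma fac).card := by
    rw [Finset.card_sigma]
    refine Finset.even_sum _ fun R hR => ?_
    simp only [rooms, Finset.mem_filter, Finset.mem_univ, true_and] at hR
    exact even_card_facets hR.2 (hno R hR.1 hR.2) i₀
  have hext₀ : (ext S₀).card = 1 := hV.card_extensions_slack i₀ ht₀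
  have hS₀ : S₀ ∈ doors := by
    obtain ⟨x, hx⟩ := Finset.card_pos.1 (hext₀ ▸ Nat.one_pos)
    simp only [ext, Finset.mem_filter, Finset.mem_univ, true_and] at hx
    simp only [doors, Finset.mem_filter, Finset.mem_univ, true_and]
    refine ⟨hx.2.mono (Finset.subset_insert _ _), ?_, ?_⟩
    · rw [Finset.card_image_of_injective _ heinj, Finset.card_erase_of_mem (Finset.mem_univ _),
        Finset.card_univ]
      omega
    · rw [Finset.image_image]
      exact (Finset.image_congr fun i _ => hc i).trans Finset.image_id
  have hodd : Odd (doors.sigma ext).card := by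
    rw [Finset.card_sigma, ← Finset.add_sum_erase _ _ hS₀, hext₀]
    refine odd_one.add_even (Finset.even_sum _ fun S hS => ?_)
    obtain ⟨hne, hS⟩ := Finset.mem_erase.1 hS
    simp only [doors, Finset.mem_filter, Finset.mem_univ, true_and] at hS
    obtain ⟨h1, h2, h3⟩ := hS
    obtain ⟨t, htS, ht⟩ : ∃ t ∈ S, t ∉ Set.range e := by
      by_contra! h
      apply hne
      have : S = (S.image c).image e := by
        rw [Finset.image_image]
        refine ((Finset.image_congr fun x hx => ?_).trans Finset.image_id).symm
        obtain ⟨i, rfl⟩ := h x hx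
        simp [hc]
      rw [this, h3]
    exact ⟨1, hV.card_extensions h1 h2 htS ht⟩
  exact Nat.not_even_iff_odd.2 hodd (hcount ▸ heven)

end Scarf
/-! ### Closed covers of the standard simplex -/

section Simplex

variable {ι : Type*} [Fintype ι]

/-- For every colouring of the points of the discrete simplex `{x | ∑ k, x k = m}` there are a
nonempty set `C` of colours and a cell of side length `card ι` such that every colour of `C` occurs
in the cell and the cell touches the face on which the coordinates outside `C` vanish. -/
theorem exists_cell_of_colouring [Nonempty ι] (m : ℕ) (c : (ι → ℕ) → ι) :
    ∃ (C : Finset ι) (a : ι → ℕ), C.Nonempty ∧ (∀ k ∉ C, a k = 0) ∧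
      ∀ i ∈ C, ∃ x : ι → ℕ, ∑ k, x k = m ∧ c x = i ∧
        ∀ k, a k ≤ x k ∧ x k ≤ a k + Fintype.card ι := by
  classical
  let T : Type _ := {x // x ∈ Finset.piAntidiag (Finset.univ : Finset ι) m}
  have hT : ∀ x : T, ∑ k, x.1 k = m := fun x => (Finset.mem_piAntidiag.1 x.2).1
  let mk : ∀ x : ι → ℕ, ∑ k, x k = m → T := fun x hx =>
    ⟨x, Finset.mem_piAntidiag.2 ⟨hx, fun _ _ => Finset.mem_univ _⟩⟩
  -- Grid points get ranks from `1` to `m + 1`, leaving `0` below and `m + 2` above for the slack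
  -- elements. The enumeration in `V` breaks ties.
  let rank : ι → T ⊕ ι → ℕ := fun i => Sum.elim (fun x => 1 + x.1 i)
    (fun j => if j = i then 0 else m + 2)
  let V : ι → T ⊕ ι → ℕ ×ₗ ℕ := fun i x => toLex (rank i x, (Fintype.equivFin (T ⊕ ι) x : ℕ))
  have hlt : ∀ i x y, rank i x < rank i y → V i x < V i y := fun i x y h =>
    Prod.Lex.toLex_lt_toLex.2 (Or.inl h)
  have hle : ∀ i x y, V i x ≤ V i y → rank i x ≤ rank i y := fun i x y h => by
    by_contra! h'
    exact absurd h (not_le.2 (hlt i y x h'))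
  have hVs : IsSlackFamily V (Sum.inr : ι → T ⊕ ι) := by
    refine ⟨fun i x y h => ?_, fun i x hx => hlt _ _ _ ?_, fun i j x hx hj => hlt _ _ _ ?_⟩
    · have := congrArg (fun p => (ofLex p).2) h
      exact (Fintype.equivFin (T ⊕ ι)).injective (Fin.ext this)
    · rcases x with x | j
      · simp [rank]
      · have : j ≠ i := fun h => hx (h ▸ rfl)
        simp [rank, this]
    · rcases x with x | k
      · have : x.1 i ≤ m := (Finset.single_le_sum (fun _ _ => Nat.zero_le _)
        (Finset.mem_univ i)).trans_eq (hT x)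
        simp only [rank, Sum.elim_inl, Sum.elim_inr, if_neg hj]
        omega
      · exact absurd ⟨k, rfl⟩ hx
  obtain ⟨i₀⟩ := ‹Nonempty ι›
  let t₀ : T := mk (Pi.single i₀ m) (by simp)
  obtain ⟨S, hdom, hcard, hcol⟩ := hVs.exists_dominant_colourful (t₀ := Sum.inl t₀) (by simp) i₀
    (c := Sum.elim (fun x => c x.1) id) (fun i => rfl)
  -- For these colours the slack element is absent from `S`, so a grid point of `S` must show the
  -- colour.
  let C : Finset ι := Finset.univ.filter fun i => Sum.inr i ∉ S
  have hdomT : ∀ y : T, ∃ i ∈ C, ∀ x : T, Sum.inl x ∈ S → y.1 i ≤ x.1 i := by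
    intro y
    obtain ⟨i, hi⟩ := hdom (Sum.inl y)
    refine ⟨i, ?_, fun x hx => ?_⟩
    · simp only [C, Finset.mem_filter, Finset.mem_univ, true_and]
      intro h
      have := hle _ _ _ (hi _ h)
      simp [rank] at this
    · have := hle _ _ _ (hi _ hx)
      simp only [rank, Sum.elim_inl] at this
      omega
  have hC : ∀ i ∈ C, ∃ x : T, Sum.inl x ∈ S ∧ c x.1 = i := by
    intro i hi
    obtain ⟨x, hx, hxi⟩ := Finset.mem_image.1 (hcol ▸ Finset.mem_univ i)
    rcases x with x | j
    · exact ⟨x, hx, hxi⟩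
    · have : j = i := hxi
      subst this
      exact absurd hx (Finset.mem_filter.1 hi).2
  obtain ⟨i₁, hi₁, -⟩ := hdomT t₀
  obtain ⟨x₁, hx₁, -⟩ := hC i₁ hi₁
  have hmin : ∀ k, ∃ x : T, Sum.inl x ∈ S ∧ ∀ y : T, Sum.inl y ∈ S → x.1 k ≤ y.1 k := by
    intro k
    obtain ⟨x, hx, hx'⟩ := (Finset.univ.filter fun x : T => Sum.inl x ∈ S).exists_min_image
      (fun x => x.1 k) ⟨x₁, by simpa using hx₁⟩
    simp only [Finset.mem_filter, Finset.mem_univ, true_and] at hx hx'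
    exact ⟨x, hx, hx'⟩
  choose p hpS hp using hmin
  let a : ι → ℕ := fun k => if k ∈ C then (p k).1 k else 0
  have hale : ∀ x : T, Sum.inl x ∈ S → ∀ k, a k ≤ x.1 k := by
    intro x hx k
    by_cases hk : k ∈ C
    · simp only [a, if_pos hk]; exact hp k x hx
    · simp [a, hk]
  -- Otherwise there is room to raise all coordinates of `a` by one and put the surplus on `i₀`,
  -- giving a grid point above the minimum of `S` in every order of `C`, against dominance.
  have hsum : m ≤ ∑ k, a k + Fintype.card ι := by
    by_contra! h
    let b : ι → ℕ := fun k => a k + 1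
    have hb : ∑ k, b k = ∑ k, a k + Fintype.card ι := by
      simp [b, Finset.sum_add_distrib]
    obtain ⟨i, hi, hi'⟩ := hdomT (mk (b + Pi.single i₀ (m - ∑ k, b k)) (by
      simp only [Pi.add_apply, Finset.sum_add_distrib, Finset.sum_pi_single', Finset.mem_univ,
        if_true]
      omega))
    have h1 := hi' (p i) (hpS i)
    have h2 : a i = (p i).1 i := by simp [a, hi]
    simp only [mk, Pi.add_apply, b] at h1
    omega
  refine ⟨C, a, ⟨i₁, hi₁⟩, fun k hk => by simp [a, hk], fun i hi => ?_⟩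
  obtain ⟨x, hxS, hx⟩ := hC i hi
  refine ⟨x.1, hT x, hx, fun k => ⟨hale x hxS k, ?_⟩⟩
  have h1 := hT x
  rw [← Finset.add_sum_erase _ _ (Finset.mem_univ k)] at h1 hsum
  have h2 : ∑ j ∈ Finset.univ.erase k, a j ≤ ∑ j ∈ Finset.univ.erase k, x.1 j :=
    Finset.sum_le_sum fun j _ => hale x hxS j
  omega

/-- If closed sets `F i` cover the standard simplex, then some point of the simplex lies in all
the `F i` for which its `i`-th coordinate is nonzero. -/
theorem exists_mem_or_coord_eq_zero_of_closed_cover [Nonempty ι] {F : ι → Set (ι → ℝ)}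
    (hF : ∀ i, IsClosed (F i)) (hcov : ∀ x ∈ stdSimplex ℝ ι, ∃ i, x ∈ F i) :
    ∃ x ∈ stdSimplex ℝ ι, ∀ i, x ∈ F i ∨ x i = 0 := by
  classical
  -- The zeros of `H` on the simplex are the points sought. The extended distance to an empty `F i`
  -- is `⊤`, which leaves the condition `x i = 0`.
  let H : (ι → ℝ) → ENNReal := fun x =>
    Finset.univ.sup fun i => min (Metric.infEDist x (F i)) (ENNReal.ofReal (x i))
  have hH : Continuous H := by
    refine Continuous.finset_sup_apply (s := Finset.univ)
      (f := fun i (x : ι → ℝ) => min (Metric.infEDist x (F i)) (ENNReal.ofReal (x i))) fun i _ => ?_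
    exact Metric.continuous_infEDist.min (ENNReal.continuous_ofReal.comp (continuous_apply i))
  have hne : (stdSimplex ℝ ι).Nonempty :=
    ⟨_, single_mem_stdSimplex ℝ (Classical.arbitrary ι)⟩
  obtain ⟨x, hx, hmin⟩ := (isCompact_stdSimplex ℝ ι).exists_isMinOn hne hH.continuousOn
  have hbound : ∀ m : ℕ, H x ≤ ENNReal.ofReal (Fintype.card ι / ((m : ℝ) + 1)) := by
    intro m
    let s : (ι → ℕ) → ι → ℝ := fun z k => (z k : ℝ) / ((m : ℝ) + 1)
    have hpos : (0 : ℝ) < (m : ℝ) + 1 := by positivity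
    have hs : ∀ z : ι → ℕ, ∑ k, z k = m + 1 → s z ∈ stdSimplex ℝ ι := by
      intro z hz
      refine ⟨fun k => by positivity, ?_⟩
      simp only [s]
      rw [← Finset.sum_div, div_eq_one_iff_eq hpos.ne']
      exact_mod_cast hz
    have hcol : ∀ z : ι → ℕ, ∃ i, ∑ k, z k = m + 1 → s z ∈ F i := fun z => by
      by_cases hz : ∑ k, z k = m + 1
      · obtain ⟨i, hi⟩ := hcov _ (hs z hz)
        exact ⟨i, fun _ => hi⟩
      · exact ⟨Classical.arbitrary ι, fun h => absurd h hz⟩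
    choose c hc using hcol
    obtain ⟨C, a, ⟨i₀, hi₀⟩, ha, hC⟩ := exists_cell_of_colouring (m + 1) c
    obtain ⟨z, hz, -, hza⟩ := hC i₀ hi₀
    -- Any point `z` of the cell will do: for `i ∈ C` the cell contains a point of `F i`, and for `i
    -- ∉ C` the coordinate `z i` is at most the side length.
    refine (isMinOn_iff.1 hmin _ (hs z hz)).trans (Finset.sup_le fun i _ => ?_)
    by_cases hi : i ∈ C
    · obtain ⟨w, hw, hwc, hwa⟩ := hC i hi
      refine (min_le_left _ _).trans ((Metric.infEDist_le_edist_of_mem (hwc ▸ hc w hw)).trans ?_)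
      rw [edist_dist]
      refine ENNReal.ofReal_le_ofReal ((dist_pi_le_iff (by positivity)).2 fun k => ?_)
      simp only [s, Real.dist_eq, ← sub_div, abs_div, abs_of_pos hpos]
      refine div_le_div_of_nonneg_right ?_ hpos.le
      have h1 : (a k : ℝ) ≤ z k := by exact_mod_cast (hza k).1
      have h2 : (z k : ℝ) ≤ a k + Fintype.card ι := by exact_mod_cast (hza k).2
      have h3 : (a k : ℝ) ≤ w k := by exact_mod_cast (hwa k).1
      have h4 : (w k : ℝ) ≤ a k + Fintype.card ι := by exact_mod_cast (hwa k).2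
      rw [abs_le]
      constructor <;> linarith
    · refine (min_le_right _ _).trans (ENNReal.ofReal_le_ofReal ?_)
      refine div_le_div_of_nonneg_right ?_ hpos.le
      have := (hza i).2
      rw [ha i hi, zero_add] at this
      exact_mod_cast this
  have hzero : H x = 0 := by
    have h1 : Filter.Tendsto (fun m : ℕ => ENNReal.ofReal (Fintype.card ι / ((m : ℝ) + 1)))
        Filter.atTop (nhds 0) := by
      rw [← ENNReal.ofReal_zero]
      refine (ENNReal.continuous_ofReal.tendsto 0).comp ?_
      have := (tendsto_one_div_add_atTop_nhds_zero_nat (𝕜 := ℝ)).const_mul (Fintype.card ι : ℝ)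
      simpa [div_eq_mul_inv] using this
    exact le_antisymm (ge_of_tendsto' h1 hbound) zero_le
  refine ⟨x, hx, fun i => ?_⟩
  have h : min (Metric.infEDist x (F i)) (ENNReal.ofReal (x i)) ≤ 0 :=
    hzero ▸ Finset.le_sup (f := fun i => min (Metric.infEDist x (F i)) (ENNReal.ofReal (x i)))
      (Finset.mem_univ i)
  rcases min_le_iff.1 h with h | h
  · left
    rw [← (hF i).closure_eq, Metric.mem_closure_iff_infEDist_zero]
    exact le_antisymm h zero_le
  · right
    exact le_antisymm (ENNReal.ofReal_eq_zero.1 (le_antisymm h zero_le)) (hx.1 i)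

end Simplex

/-! ### The Ky Fan inequality -/

section KyFan

variable {E : Type*} [AddCommGroup E] [Module ℝ E] [TopologicalSpace E] [ContinuousAdd E]
  [ContinuousSMul ℝ E]

/-- The Ky Fan inequality for finitely many test points. -/
theorem exists_forall_nonpos_of_finite {ι : Type*} [Fintype ι] [Nonempty ι] {K : Set E}
    (hK : Convex ℝ K) {φ : E → E → ℝ} (hφc : ∀ u ∈ K, ContinuousOn (φ u) K)
    (hφ : ∀ w ∈ K, ConcaveOn ℝ K fun u => φ u w) (hdiag : ∀ w ∈ K, φ w w ≤ 0)
    (u : ι → E) (hu : ∀ i, u i ∈ K) : ∃ w ∈ K, ∀ i, φ (u i) w ≤ 0 := by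
  let W : (ι → ℝ) → E := fun l => ∑ i, l i • u i
  have hW : Continuous W := continuous_finsetSum _ fun i _ =>
    (continuous_apply i).smul continuous_const
  have hWK : ∀ l ∈ stdSimplex ℝ ι, W l ∈ K := fun l hl =>
    hK.sum_mem (fun i _ => hl.1 i) hl.2 fun i _ => hu i
  let h : ι → (ι → ℝ) → ℝ := fun i l => max (φ (u i) (W l)) 0
  have hh : ∀ i, ContinuousOn (h i) (stdSimplex ℝ ι) := fun i =>
    ContinuousOn.sup ((hφc _ (hu i)).comp hW.continuousOn hWK) continuousOn_const
  -- These sets cover the simplex: if all inequalities failed, summing them would give `∑ h < ∑ h`.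
  -- At a point of all of them the same sum forces equality, so `l` is proportional to `h` if `h ≠
  -- 0`.
  let F : ι → Set (ι → ℝ) := fun i => {l ∈ stdSimplex ℝ ι | l i * ∑ j, h j l ≤ h i l}
  have hF : ∀ i, IsClosed (F i) := fun i =>
    (isClosed_stdSimplex ℝ ι).isClosed_le ((continuous_apply i).continuousOn.mul
      (continuousOn_finsetSum _ fun j _ => hh j)) (hh i)
  obtain ⟨l, hl, hl'⟩ := exists_mem_or_coord_eq_zero_of_closed_cover hF fun l hl => by
    by_contra! hno
    have : ∑ i, h i l < ∑ i, l i * ∑ j, h j l :=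
      Finset.sum_lt_sum_of_nonempty Finset.univ_nonempty fun i _ => by
        by_contra! hle
        exact hno i ⟨hl, hle⟩
    rw [← Finset.sum_mul, hl.2, one_mul] at this
    exact lt_irrefl _ this
  have hle : ∀ i, l i * ∑ j, h j l ≤ h i l := fun i => by
    rcases hl' i with hi | hi
    · exact hi.2
    · rw [hi, zero_mul]; exact le_max_right _ _
  have heq : ∀ i, l i * ∑ j, h j l = h i l := fun i =>
    (Finset.sum_eq_sum_iff_of_le fun i _ => hle i).1
      (by rw [← Finset.sum_mul, hl.2, one_mul]) i (Finset.mem_univ i)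
  refine ⟨W l, hWK l hl, ?_⟩
  -- If `h ≠ 0`, each `i` with `l i > 0` has `φ (u i) (W l) > 0`, and concavity makes `φ` positive
  -- on the diagonal.
  by_contra! hex
  obtain ⟨k, hk⟩ := hex
  have hpos : 0 < ∑ j, h j l := Finset.sum_pos' (fun j _ => le_max_right _ _)
    ⟨k, Finset.mem_univ k, lt_max_of_lt_left hk⟩
  have hlk : 0 < l k := by
    have : 0 < l k * ∑ j, h j l := heq k ▸ lt_max_of_lt_left hk
    exact (pos_iff_pos_of_mul_pos this).2 hpos
  have hterm : ∀ i, 0 ≤ l i * φ (u i) (W l) := by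
    intro i
    rcases (hl.1 i).eq_or_lt with hi | hi
    · rw [← hi, zero_mul]
    · have : 0 < h i l := heq i ▸ mul_pos hi hpos
      refine mul_nonneg hi.le ?_
      by_contra! hneg
      rw [show h i l = 0 from max_eq_right hneg.le] at this
      exact lt_irrefl _ this
  have h1 : 0 < ∑ i, l i * φ (u i) (W l) :=
    Finset.sum_pos' (fun i _ => hterm i) ⟨k, Finset.mem_univ k, mul_pos hlk hk⟩
  have h2 := (hφ _ (hWK l hl)).le_map_sum (t := Finset.univ) (fun i _ => hl.1 i) hl.2
    (fun i _ => hu i)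
  exact absurd (h2.trans (hdiag _ (hWK l hl))) (not_le.2 h1)

/-- The **Ky Fan inequality**. -/
theorem exists_forall_nonpos_of_concaveOn {K : Set E} (hK : Convex ℝ K) (hKc : IsCompact K)
    (hKne : K.Nonempty) {φ : E → E → ℝ} (hφc : ∀ u ∈ K, ContinuousOn (φ u) K)
    (hφ : ∀ w ∈ K, ConcaveOn ℝ K fun u => φ u w) (hdiag : ∀ w ∈ K, φ w w ≤ 0) :
    ∃ w ∈ K, ∀ u ∈ K, φ u w ≤ 0 := by
  have : CompactSpace K := isCompact_iff_compactSpace.1 hKc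
  let Z : K → Set K := fun u => {w | φ u w ≤ 0}
  have hZ : ∀ u, IsClosed (Z u) := fun u =>
    isClosed_le (continuousOn_iff_continuous_domRestrict.1 (hφc _ u.2)) continuous_const
  have hne : (⋂ u, Z u).Nonempty := by
    refine CompactSpace.iInter_nonempty hZ fun s => ?_
    obtain ⟨k, hk⟩ := hKne
    -- The extra index `none` keeps the family nonempty when `s` is empty.
    obtain ⟨w, hw, hw'⟩ := exists_forall_nonpos_of_finite hK hφc hφ hdiag
      (fun i : Option s => i.elim k fun u => (u : K)) (fun i => by
        cases i with
        | none => exact hk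
        | some u => exact u.1.2)
    exact ⟨⟨w, hw⟩, Set.mem_iInter₂.2 fun u hu => hw' (some ⟨u, hu⟩)⟩
  obtain ⟨w, hw⟩ := hne
  exact ⟨w, w.2, fun u hu => Set.mem_iInter.1 hw ⟨u, hu⟩⟩

end KyFan
/-! ### Expected payoffs of controlled chains -/

namespace ControlledChain

open Matrix

theorem integral_rowMeasure {N : ℕ} (α : stdSimplex ℝ (Fin N)) (g : Fin N → ℝ) :
    ∫ x, g x ∂rowMeasure α = (α : Fin N → ℝ) ⬝ᵥ g := by
  rw [rowMeasure, integral_finsetSum_measure fun j _ =>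
    (Integrable.of_finite (f := g)).smul_measure ENNReal.ofReal_ne_top]
  simp only [integral_smul_measure, integral_dirac, smul_eq_mul, dotProduct]
  exact Finset.sum_congr rfl fun j _ => congrArg (· * g j) (ENNReal.toReal_ofReal (α.2.1 j))

instance {N : ℕ} (π : ℕ → TransitionMatrix N) (i : Fin N) :
    IsProbabilityMeasure (chainLaw π i) := by
  unfold chainLaw; infer_instance

theorem integral_chainLaw_zero {N : ℕ} (π : ℕ → TransitionMatrix N) (i : Fin N)
    (g : Fin N → ℝ) : ∫ x, g (x 0) ∂chainLaw π i = g i := by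
  rw [chainLaw, Kernel.integral_traj _ (Measurable.aestronglyMeasurable (by fun_prop))]
  simp [Function.updateFinset]

theorem integrable_comp_eval {N : ℕ} (μ : Measure (ℕ → Fin N)) [IsFiniteMeasure μ]
    (g : Fin N → ℝ) (t : ℕ) : Integrable (fun x => g (x t)) μ :=
  (Integrable.of_finite (f := g)).comp_measurable (μ := μ) (measurable_pi_apply t)

/-- Tower property: condition on the history up to time `t`, of which only the current state
matters. -/
theorem integral_chainLaw_succ {N : ℕ} (π : ℕ → TransitionMatrix N) (i : Fin N)
    (g : Fin N → ℝ) (t : ℕ) :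
    ∫ x, g (x (t + 1)) ∂chainLaw π i =
      ∫ x, (π t (x t) : Fin N → ℝ) ⬝ᵥ g ∂chainLaw π i := by
  have hstep : ∀ h : (k : Finset.Iic t) → Fin N,
      ∫ y, g (y (t + 1)) ∂Kernel.traj (X := fun _ => Fin N) (fun n => historyKernel (π n) n) t h =
        (π t (h ⟨t, Finset.mem_Iic.2 le_rfl⟩) : Fin N → ℝ) ⬝ᵥ g := by
    intro h
    rw [← integral_rowMeasure]
    have := congrArg (fun η : Kernel _ (Fin N) => ∫ y, g y ∂η h)
      (Kernel.map_traj_succ_self (X := fun _ => Fin N)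
        (κ := fun n => historyKernel (π n) n) (a := t))
    rw [Kernel.map_apply _ (by fun_prop),
      integral_map (measurable_pi_apply _).aemeasurable
        Measurable.of_discrete.aestronglyMeasurable] at this
    exact this
  rw [chainLaw, ← Kernel.integral_traj_partialTraj (Nat.zero_le t) (integrable_comp_eval _ g _)]
  simp_rw [hstep]
  rw [← Kernel.traj_map_frestrictLe_apply, integral_map (by fun_prop)
    Measurable.of_discrete.aestronglyMeasurable]
  rfl

/-- The matrix of transition probabilities. -/
def TransitionMatrix.toMatrix {N : ℕ} (u : TransitionMatrix N) : Matrix (Fin N) (Fin N) ℝ :=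
  fun i => u i

/-- Each induction step peels off the last transition and replaces `g` by `w.toMatrix *ᵥ g`, so `g`
is quantified after `t`. -/
theorem integral_chainLaw_concat_succ {N : ℕ} (u w : TransitionMatrix N) (i : Fin N) (t : ℕ) :
    ∀ g : Fin N → ℝ, ∫ x, g (x (t + 1)) ∂chainLaw (concat u w) i =
      (u i : Fin N → ℝ) ⬝ᵥ (w.toMatrix ^ t *ᵥ g) := by
  induction t with
  | zero =>
    intro g
    rw [integral_chainLaw_succ, pow_zero, one_mulVec]
    exact integral_chainLaw_zero _ i fun k => (u k : Fin N → ℝ) ⬝ᵥ g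
  | succ t ih =>
    intro g
    rw [integral_chainLaw_succ, pow_succ, ← mulVec_mulVec, ← ih]
    rfl

/-- Averages with respect to a probability vector do not increase the supremum norm. -/
theorem abs_dotProduct_le {N : ℕ} {α : Fin N → ℝ} (hα : α ∈ stdSimplex ℝ (Fin N))
    {g : Fin N → ℝ} {b : ℝ} (hg : ∀ k, |g k| ≤ b) : |α ⬝ᵥ g| ≤ b := by
  refine (Finset.abs_sum_le_sum_abs _ _).trans ?_
  calc ∑ j, |α j * g j| ≤ ∑ j, α j * b := Finset.sum_le_sum fun j _ => by
        rw [abs_mul, abs_of_nonneg (hα.1 j)]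
        exact mul_le_mul_of_nonneg_left (hg j) (hα.1 j)
    _ = b := by rw [← Finset.sum_mul, hα.2, one_mul]

/-- Powers of row-stochastic matrices do not increase the supremum norm. -/
theorem abs_pow_mulVec_le {N : ℕ} {w : Matrix (Fin N) (Fin N) ℝ}
    (hw : ∀ i, w i ∈ stdSimplex ℝ (Fin N)) {g : Fin N → ℝ} {b : ℝ} (hg : ∀ k, |g k| ≤ b)
    (t : ℕ) : ∀ j, |(w ^ t *ᵥ g) j| ≤ b := by
  induction t with
  | zero => simpa using hg
  | succ t ih =>
    intro j
    rw [pow_succ', ← mulVec_mulVec]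
    exact abs_dotProduct_le (hw j) ih

/-- The expected payoff from time `1` on, as a function of the state at time `1`, when the chain is
governed by `w` from then on. -/
noncomputable def continuation {N : ℕ} (κ : ℕ → Fin N → (Fin N → ℝ) → ℝ) (w : Matrix (Fin N) (Fin N) ℝ) :
    Fin N → ℝ :=
  fun j => ∑' t, (w ^ t *ᵥ fun k => κ (t + 1) k (w k)) j

section Bounded

variable {N : ℕ} {κ : ℕ → Fin N → (Fin N → ℝ) → ℝ} {b : ℕ → ℝ}

/-- The summable bound allows expectation and series to be exchanged. The deviation `u` then enters
only through row `i`, linearly apart from `κ 0 i`. -/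
theorem policyPayoff_concat (hb : Summable b)
    (hκ : ∀ t i, ∀ α ∈ stdSimplex ℝ (Fin N), |κ t i α| ≤ b t) (u w : TransitionMatrix N)
    (i : Fin N) :
    policyPayoff κ i (concat u w) =
      κ 0 i (u i) + (u i : Fin N → ℝ) ⬝ᵥ continuation κ w.toMatrix := by
  have hint : ∀ t, Integrable (fun x : ℕ → Fin N => κ t (x t) (concat u w t (x t)))
      (chainLaw (concat u w) i) := fun t =>
    integrable_comp_eval _ (fun k => κ t k (concat u w t k)) t
  have hnorm : ∀ t, ∫ x, ‖κ t (x t) (concat u w t (x t))‖ ∂chainLaw (concat u w) i ≤ b t := by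
    intro t
    refine (integral_mono (hint t).norm (integrable_const (b t))
      fun x => hκ t _ _ (concat u w t (x t)).2).trans_eq ?_
    simp
  have hsum := hasSum_integral_of_summable_integral_norm hint
    (Summable.of_nonneg_of_le (fun t => integral_nonneg fun x => norm_nonneg _) hnorm hb)
  have h0 : ∫ x, κ 0 (x 0) (concat u w 0 (x 0)) ∂chainLaw (concat u w) i = κ 0 i (u i) :=
    integral_chainLaw_zero _ i fun k => κ 0 k (u k)
  have h1 : ∀ t, ∫ x, κ (t + 1) (x (t + 1)) (concat u w (t + 1) (x (t + 1)))
      ∂chainLaw (concat u w) i =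
        (u i : Fin N → ℝ) ⬝ᵥ (w.toMatrix ^ t *ᵥ fun k => κ (t + 1) k (w.toMatrix k)) := fun t =>
    integral_chainLaw_concat_succ u w i t fun k => κ (t + 1) k (w k)
  rw [policyPayoff, ← hsum.tsum_eq, hsum.summable.tsum_eq_zero_add, h0]
  simp_rw [h1, dotProduct, continuation]
  have hs : ∀ j, Summable fun t => (w.toMatrix ^ t *ᵥ fun k => κ (t + 1) k (w.toMatrix k)) j :=
    fun j => Summable.of_norm_bounded ((summable_nat_add_iff 1).2 hb) fun t =>
      abs_pow_mulVec_le (fun k => (w k).2) (fun k => hκ (t + 1) k _ (w k).2) t j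
  rw [Summable.tsum_finsetSum fun j _ => (hs j).mul_left _]
  simp_rw [tsum_mul_left]

/-- Weierstrass M-test: each term is continuous in `w`, and stochastic matrices preserve the bound
`b (t + 1)`. -/
theorem continuousOn_continuation (hb : Summable b)
    (hκ : ∀ t i, ∀ α ∈ stdSimplex ℝ (Fin N), |κ t i α| ≤ b t)
    (hκc : ∀ t i, ContinuousOn (κ t i) (stdSimplex ℝ (Fin N)))
    {K : Set (Fin N → Fin N → ℝ)} (hK : ∀ w ∈ K, ∀ i, w i ∈ stdSimplex ℝ (Fin N)) :
    ContinuousOn (fun w : Fin N → Fin N → ℝ => continuation κ w) K := by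
  refine continuousOn_pi.2 fun j => continuousOn_tsum (u := fun t => b (t + 1)) (fun t => ?_)
    ((summable_nat_add_iff 1).2 hb) fun t w hw =>
      abs_pow_mulVec_le (hK w hw) (fun k => hκ (t + 1) k _ (hK w hw k)) t j
  change ContinuousOn (fun w : Matrix (Fin N) (Fin N) ℝ =>
    ∑ k, (w ^ t) j k * κ (t + 1) k (w k)) K
  refine continuousOn_finsetSum _ fun k _ => ContinuousOn.mul ?_ ?_
  · have : Continuous fun w : Matrix (Fin N) (Fin N) ℝ => (w ^ t) j k :=
      (continuous_pow t).matrix_elem j k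
    exact this.continuousOn
  · exact (hκc (t + 1) k).comp (continuous_apply k).continuousOn fun w hw => hK w hw k

end Bounded

end ControlledChain
-- Existence of an equilibrium
open ControlledChain Matrix in
theorem theorem5p1 (N : ℕ) (κ : ℕ → Fin N → (Fin N → ℝ) → ℝ) (A : Fin N → Set (Fin N → ℝ))
    (hκ_cont : Continuous fun p : ℕ × Fin N × stdSimplex ℝ (Fin N) => κ p.1 p.2.1 p.2.2)
    (hκ_sum : Summable fun t : ℕ => ⨆ p : Fin N × stdSimplex ℝ (Fin N), |κ t p.1 p.2|)
    (hA_sub : ∀ i, A i ⊆ stdSimplex ℝ (Fin N))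
    (hA_nonempty : ∀ i, (A i).Nonempty)
    (hA_convex : ∀ i, Convex ℝ (A i))
    (hA_closed : ∀ i, IsClosed (A i))
    (hκ_concave : ∀ i, ConcaveOn ℝ (stdSimplex ℝ (Fin N)) (κ 0 i)) :
    ∃ w : ControlledChain.TransitionMatrix N, ControlledChain.IsEquilibrium κ A w := by
  have hbound : ∀ t i, ∀ α ∈ stdSimplex ℝ (Fin N),
      |κ t i α| ≤ ⨆ p : Fin N × stdSimplex ℝ (Fin N), |κ t p.1 p.2| := by
    intro t i α hα
    -- An unbounded real supremum would take the default value `0`; compactness of the simplex rules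
    -- this out.
    have hc : Continuous fun p : Fin N × stdSimplex ℝ (Fin N) => |κ t p.1 p.2| :=
      (hκ_cont.comp (continuous_const.prodMk continuous_id)).abs
    exact le_ciSup (isCompact_range hc).bddAbove (i, ⟨α, hα⟩)
  have hκc : ∀ t i, ContinuousOn (κ t i) (stdSimplex ℝ (Fin N)) := fun t i =>
    continuousOn_iff_continuous_domRestrict.2
      (hκ_cont.comp (continuous_const.prodMk (continuous_const.prodMk continuous_id)))
  let K : Set (Fin N → Fin N → ℝ) := Set.univ.pi A
  have hKmem : ∀ w ∈ K, ∀ i, w i ∈ A i := fun w hw i => hw i (Set.mem_univ i)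
  have hKS : ∀ w ∈ K, ∀ i, w i ∈ stdSimplex ℝ (Fin N) := fun w hw i => hA_sub i (hKmem w hw i)
  have hK : Convex ℝ K := convex_pi fun i _ => hA_convex i
  have hKc : IsCompact K := isCompact_univ_pi fun i =>
    (isCompact_stdSimplex ℝ (Fin N)).of_isClosed_subset (hA_closed i) (hA_sub i)
  have hKne : K.Nonempty := Set.univ_pi_nonempty_iff.2 hA_nonempty
  let h : Fin N → (Fin N → ℝ) → (Fin N → Fin N → ℝ) → ℝ := fun i α w =>
    κ 0 i α + α ⬝ᵥ continuation κ w
  have hG := continuousOn_continuation hκ_sum hbound hκc hKS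
  have hdot : ∀ α : (Fin N → Fin N → ℝ) → Fin N → ℝ, Continuous α →
      ContinuousOn (fun w => α w ⬝ᵥ continuation κ w) K := fun α hα =>
    continuousOn_finsetSum _ fun j _ =>
      ((continuous_apply j).comp hα).continuousOn.mul ((continuous_apply j).comp_continuousOn hG)
  obtain ⟨w, hw, hmax⟩ := exists_forall_nonpos_of_concaveOn hK hKc hKne
    (φ := fun u w => ∑ i, (h i (u i) w - h i (w i) w))
    (fun u _ => continuousOn_finsetSum _ fun i _ =>
      (continuousOn_const.add (hdot (fun _ => u i) continuous_const)).sub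
        (((hκc 0 i).comp (continuous_apply i).continuousOn fun w hw => hKS w hw i).add
          (hdot (fun w => w i) (continuous_apply i))))
    (fun w _ => by
      refine ⟨hK, fun x hx y hy a b ha hb hab => ?_⟩
      simp only [smul_eq_mul, Finset.mul_sum, ← Finset.sum_add_distrib]
      refine Finset.sum_le_sum fun i _ => ?_
      have h1 := (hκ_concave i).2 (hKS x hx i) (hKS y hy i) ha hb hab
      simp only [h, Pi.add_apply, Pi.smul_apply, smul_eq_mul, add_dotProduct,
        smul_dotProduct] at h1 ⊢
      linear_combination h1 - (κ 0 i (w i) + w i ⬝ᵥ continuation κ w) * hab)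
    (fun w _ => by simp)
  let w' : TransitionMatrix N := fun i => ⟨w i, hKS w hw i⟩
  refine ⟨w', hKmem w hw, fun i u hu => ?_⟩
  have hself : (fun _ : ℕ => w') = concat w' w' := funext fun t => by cases t <;> rfl
  rw [payoff, hself, policyPayoff_concat hκ_sum hbound, policyPayoff_concat hκ_sum hbound]
  -- Changing only row `i` of `w` stays in the product set `K` and cancels every other summand.
  have hdev := hmax (Function.update w i (u i)) fun k _ => by
    by_cases hk : k = i
    · subst hk; simpa using hu k
    · simpa [hk] using hKmem w hw k
  rw [Finset.sum_eq_single i (fun k _ hk => by simp [hk]) (by simp), Function.update_self] at hdev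
  exact sub_nonpos.1 hdev
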